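/- Let $G$ be a topological group; call it TDLC if it is totally disconnected and locally compact. A $\mathbb{Q}[G]$-module is \emph{discrete} if the stabilizer of each of its elements is open in $G$. A \emph{proper} $G$-set is a non-empty $G$-set all of whose point stabilizers are compact and open; for a proper $G$-set $\Omega$ the discrete module $\mathbb{Q}[\Omega]$ is called a proper permutation module, and it is finitely generated if and only if $\Omega$ has finitely many $G$-orbits. It carries the norm $\|\sum_\omega a_\omega\omega\|_1=\sum_\omega|a_\omega|$. A TDLC-group $G$ is of \emph{type $\mathrm{FP}_m$} if there is an exact sequence of $\mathbb{Q}[G]$-modules $$\mathbb{Q}[\Omega_m]\xrightarrow{\delta_m}\cdots\to\mathbb{Q}[\Omega_1]\xrightarrow{\delta_1}\mathbb{Q}[\Omega_0]\xrightarrow{\delta_0}\mathbb{Q}\to0,$$ where $\mathbb{Q}$ is the trivial module and every $\mathbb{Q}[\Omega_i]$ is a finitely generated proper permutation module (a partial proper permutation resolution of finite type, of length $m$). It is of \emph{type $\mathrm{FP}_\infty$} if it is of type $\mathrm{FP}_m$ for every $m\in\mathbb{N}$. The \emph{rational discrete cohomological dimension} $\mathrm{cd}_{\mathbb{Q}}(G)\in\mathbb{N}\cup\{\infty\}$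 is the minimal length of a projective resolution of $\mathbb{Q}$ in the category of discrete $\mathbb{Q}[G]$-modules. A \emph{filling pseudo-norm} on a finitely generated discrete $\mathbb{Q}[G]$-module $M$ is a function $m\mapsto\inf\{\|x\|_1 : x\in\mathbb{Q}[\Omega],\ \partial(x)=m\}$, where $\partial\colon\mathbb{Q}[\Omega]\to M$ is a surjective morphism from a finitely generated proper permutation module; it is called a \emph{filling norm} if it separates points. Two norms are \emph{equivalent} if each is bounded by a constant multiple of the other. A finitely generated submodule $N\subseteq M$ is \emph{undistorted} in $M$ if the restriction to $N$ of a filling norm on $M$ is equivalent to a filling norm on $N$. The group $G$ satisfies the \emph{weak $n$-dimensional linear isoperimetric inequality} if there is a partial proper permutation resolution of $\mathbb{Q}$ of finite type, of length $n+1$ and with notation as above, such that $\ker(\delta_n)$ is undistorted in $\mathbb{Q}[\Omega_n]$. \textbf{Theorem.} Let $n\in\mathbb{N}$ and let $G$ be a TDLC-group of type $\mathrm{FP}_\infty$ with $\mathrm{cd}_{\mathbb{Q}}(G)=n+1$ that satisfies the weak $n$-dimensional linear isoperimetric inequality. Then every closed subgroup $H$ of $G$ of type $\mathrm{FP}_{n+1}$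 satisfies the weak $n$-dimensional linear isoperimetric inequality. -/

import Mathlib

open Representation
open scoped MonoidAlgebra

universe u v

namespace TDLC

/-! Throughout, a `ℚ[G]`-module is a representation of `G` on a `ℚ`-vector space, a `ℚ[G]`-submodule
is a `Subrepresentation`, and a morphism is an `IntertwiningMap`. -/

section Modules

variable (G : Type u) [Group G] [TopologicalSpace G]

/-- A `ℚ[G]`-module is discrete if the stabilizer of each of its elements is open in `G`. -/
def IsDiscrete {G : Type u} [Group G] [TopologicalSpace G] {V : Type v} [AddCommGroup V]
    [Module ℚ V] (ρ : Representation ℚ G V) : Prop :=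
  ∀ x : V, IsOpen {g : G | ρ g x = x}

/-- A proper `G`-set: non-empty, with all stabilizers open and compact. -/
structure IsProperGSet (Ω : Type v) [MulAction G Ω] : Prop where
  nonempty : Nonempty Ω
  isOpen_stabilizer : ∀ ω : Ω, IsOpen (MulAction.stabilizer G ω : Set G)
  isCompact_stabilizer : ∀ ω : Ω, IsCompact (MulAction.stabilizer G ω : Set G)

/-- A proper `G`-set with finitely many orbits; equivalently, its permutation module `ℚ[Ω]` is a
finitely generated proper permutation module. -/
structure IsFiniteProperGSet (Ω : Type v) [MulAction G Ω] : Prop extends IsProperGSet G Ω where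
  finite_orbits : Finite (MulAction.orbitRel.Quotient G Ω)

/-- The permutation module `ℚ[Ω]` of a `G`-set `Ω`. -/
noncomputable abbrev perm (Ω : Type v) [MulAction G Ω] : Representation ℚ G ℚ[Ω] :=
  Representation.ofMulAction ℚ G Ω

/-- The trivial module `ℚ`. -/
noncomputable abbrev trivialModule : Representation ℚ G ℚ :=
  Representation.trivial ℚ G ℚ

end Modules

section Norms

/-- The `ℓ₁`-norm on `ℚ[Ω]`. -/
noncomputable def l1Norm {Ω : Type v} (x : ℚ[Ω]) : ℝ :=
  x.coeff.sum fun _ a => |(a : ℝ)|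

/-- `ν' ⪯ ν`: there is `C > 0` with `ν' ≤ C ν` everywhere. -/
def NormLE {V : Type v} (ν' ν : V → ℝ) : Prop :=
  ∃ C : ℝ, 0 < C ∧ ∀ x : V, ν' x ≤ C * ν x

/-- Equivalence of (pseudo-)norms. -/
def NormEquiv {V : Type v} (ν ν' : V → ℝ) : Prop :=
  NormLE ν ν' ∧ NormLE ν' ν

variable {G : Type u} [Group G] [TopologicalSpace G]
  {V : Type v} [AddCommGroup V] [Module ℚ V]

/-- `m ↦ inf {‖x‖₁ : x ∈ ℚ[Ω], ∂ x = m}`, the filling pseudo-norm induced by `∂ : ℚ[Ω] → V`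
(used only for surjective `∂`, so that the infimum is over a non-empty set). -/
noncomputable def fillingPseudoNorm {ρ : Representation ℚ G V} {Ω : Type u} [MulAction G Ω]
    (del : IntertwiningMap (perm G Ω) ρ) (m : V) : ℝ :=
  sInf {r : ℝ | ∃ x : ℚ[Ω], del x = m ∧ l1Norm x = r}

/-- `ν` is a filling pseudo-norm of the module: it is induced by a surjection from a finitely
generated proper permutation module. (Only finitely generated discrete modules have one.) -/
def IsFillingPseudoNorm (ρ : Representation ℚ G V) (ν : V → ℝ) : Prop :=
  ∃ (Ω : Type u) (_ : MulAction G Ω) (del : IntertwiningMap (perm G Ω) ρ),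
    IsFiniteProperGSet G Ω ∧ Function.Surjective del ∧ ν = fillingPseudoNorm del

/-- A filling norm: a filling pseudo-norm which separates points. -/
def IsFillingNorm (ρ : Representation ℚ G V) (ν : V → ℝ) : Prop :=
  IsFillingPseudoNorm ρ ν ∧ ∀ x : V, ν x = 0 → x = 0

/-- `N` is undistorted with respect to the norm `ν` on the ambient module: the restriction of `ν`
to `N` is equivalent to a filling norm on `N`. -/
def IsUndistortedWrt {ρ : Representation ℚ G V} (N : Subrepresentation ρ) (ν : V → ℝ) : Prop :=
  ∃ ν' : N.toSubmodule → ℝ, IsFillingNorm N.toRepresentation ν' ∧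
    NormEquiv (fun x : N.toSubmodule => ν (x : V)) ν'

/-- `N` is undistorted in the ambient module: undistorted with respect to its filling norm. -/
def IsUndistorted {ρ : Representation ℚ G V} (N : Subrepresentation ρ) : Prop :=
  ∃ ν : V → ℝ, IsFillingNorm ρ ν ∧ IsUndistortedWrt N ν

end Norms

section Finiteness

variable (G : Type u) [Group G] [TopologicalSpace G]

/-- A sequence of permutation modules `⋯ → ℚ[Ω₁] → ℚ[Ω₀] → ℚ`; `d i` is the boundary map
`δ_{i+1}`, and `aug` is `δ₀`. -/
structure PermSeq (G : Type u) [Group G] where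
  Ω : ℕ → Type u
  [action : ∀ i, MulAction G (Ω i)]
  aug : IntertwiningMap (Representation.ofMulAction ℚ G (Ω 0)) (Representation.trivial ℚ G ℚ)
  d : ∀ i, IntertwiningMap (Representation.ofMulAction ℚ G (Ω (i + 1)))
    (Representation.ofMulAction ℚ G (Ω i))

attribute [instance] PermSeq.action

/-- `ker δ_i ⊆ ℚ[Ω_i]`. -/
noncomputable def PermSeq.ker {G : Type u} [Group G] (R : PermSeq G) :
    ∀ i, Subrepresentation (Representation.ofMulAction ℚ G (R.Ω i))
  | 0 => R.aug.ker
  | i + 1 => (R.d i).ker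

/-- The part `ℚ[Ω_n] → ⋯ → ℚ[Ω₀] → ℚ → 0` of the sequence is a partial proper permutation
resolution of finite type of the trivial module. Terms in degrees above `n` are irrelevant. -/
structure PermSeq.IsPartialResolution (R : PermSeq G) (n : ℕ) : Prop where
  finiteProper : ∀ i ≤ n, IsFiniteProperGSet G (R.Ω i)
  surjective_aug : Function.Surjective R.aug
  exact : ∀ i < n, (R.d i).range = R.ker i

/-- Type `FP_n` (over `ℚ`, in the category of discrete `ℚ[G]`-modules). -/
def IsTypeFP (n : ℕ) : Prop :=
  ∃ R : PermSeq G, R.IsPartialResolution G n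

/-- Type `FP_∞`. -/
def IsTypeFPInfty : Prop :=
  ∀ n : ℕ, IsTypeFP G n

/-- Projective objects of the category of discrete `ℚ[G]`-modules. -/
def IsProjectiveDiscrete {G : Type u} [Group G] [TopologicalSpace G] {P : Type u} [AddCommGroup P]
    [Module ℚ P] (π : Representation ℚ G P) : Prop :=
  IsDiscrete π ∧
    ∀ (M N : Type u) [AddCommGroup M] [Module ℚ M] [AddCommGroup N] [Module ℚ N]
      (ρ : Representation ℚ G M) (σ : Representation ℚ G N),
      IsDiscrete ρ → IsDiscrete σ →
      ∀ (p : IntertwiningMap ρ σ) (f : IntertwiningMap π σ), Function.Surjective p →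
        ∃ l : IntertwiningMap π ρ, p.comp l = f

/-- A projective resolution `0 → P_n → ⋯ → P₀ → ℚ → 0` of the trivial module in the category of
discrete `ℚ[G]`-modules, extended by zero in degrees above `n`. -/
structure ProjResolution (n : ℕ) where
  P : ℕ → Type u
  [addCommGroup : ∀ i, AddCommGroup (P i)]
  [module : ∀ i, Module ℚ (P i)]
  rep : ∀ i, Representation ℚ G (P i)
  projective : ∀ i, IsProjectiveDiscrete (rep i)
  aug : IntertwiningMap (rep 0) (Representation.trivial ℚ G ℚ)
  d : ∀ i, IntertwiningMap (rep (i + 1)) (rep i)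
  surjective_aug : Function.Surjective aug
  exact_zero : (d 0).range = aug.ker
  exact_succ : ∀ i, (d (i + 1)).range = (d i).ker
  eq_zero : ∀ i, n < i → Subsingleton (P i)

/-- The rational discrete cohomological dimension: the minimal length of a projective resolution
of `ℚ`, or `∞` if there is no finite one. -/
noncomputable def cdQ : ℕ∞ :=
  sInf {m : ℕ∞ | ∃ n : ℕ, Nonempty (ProjResolution G n) ∧ m = n}

/-- The weak `n`-dimensional linear isoperimetric inequality: there is a partial proper permutation
resolution `ℚ[Ω_{n+1}] → ⋯ → ℚ[Ω₀] → ℚ → 0` of finite type such that `ker δ_n` is undistorted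
in `ℚ[Ω_n]`. -/
def WeakLinearIsoperimetric (n : ℕ) : Prop :=
  ∃ R : PermSeq G, R.IsPartialResolution G (n + 1) ∧ IsUndistorted (R.ker n)

end Finiteness

end TDLC

/-! Let `R` be the resolution of $G$ with undistorted $n$-cycles $N$, and
$\pi\colon\mathbb{Q}[\Lambda]\to N$ a surjection inducing a filling norm on $N$. Dimension at most
$n+1$ makes $\pi$ split (`exists_section_of_projResolution`), and undistortion makes the section $s$
bounded for the $\ell_1$-norms (`exists_section_bound`). Both facts pass to $H$ by restriction.

Let `S` be a resolution for $H$. Over $H$ the restricted `R` is still projective, so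
`AugSeq.exists_comparison` writes the identity on the $n$-cycles of `S` as $gf+h$, hence $z=g\pi s
f(z)+h(z)$. Here $f$ and $s$ are bounded, and $h$ is defined on all $n$-chains, so $h(z)$ has a
linearly bounded filling.

The obstacle is that $\Lambda$ may have infinitely many $H$-orbits, so $g\pi$ need not have bounded
fillings. But the cycles of `S` are finitely generated, so $sf$ takes them into the span of finitely
many orbits (`exists_orbits_support`), which suffices for `exists_bounded_lift`. -/

namespace TDLC

/-! ### Discrete modules and averaging over compact subgroups. -/

section Discrete

variable {G : Type u} [Group G] [TopologicalSpace G]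

/-- The stabilizer of a vector, as a subgroup. -/
def vectorStabilizer {V : Type v} [AddCommGroup V] [Module ℚ V] (ρ : Representation ℚ G V)
    (x : V) : Subgroup G where
  carrier := {g | ρ g x = x}
  one_mem' := by simp
  mul_mem' {a b} ha hb := by
    simp only [Set.mem_ofPred_eq] at ha hb ⊢
    rw [map_mul, Module.End.mul_apply, hb, ha]
  inv_mem' {a} ha := by
    simp only [Set.mem_ofPred_eq] at ha ⊢
    conv_lhs => rw [← ha]
    rw [← Module.End.mul_apply, ← map_mul]
    simp

theorem isDiscrete_toRepresentation {V : Type v} [AddCommGroup V] [Module ℚ V]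
    {ρ : Representation ℚ G V} (hρ : IsDiscrete ρ) (N : Subrepresentation ρ) :
    IsDiscrete N.toRepresentation := by
  intro x
  convert hρ (x : V) using 1
  ext g
  exact Subtype.ext_iff

theorem isDiscrete_trivial (V : Type v) [AddCommGroup V] [Module ℚ V] :
    IsDiscrete (Representation.trivial ℚ G V) := by
  intro x
  simp

variable [IsTopologicalGroup G]

theorem IsDiscrete.isOpen_setOf_apply_eq {V : Type v} [AddCommGroup V] [Module ℚ V]
    {ρ : Representation ℚ G V} (hρ : IsDiscrete ρ) (x y : V) : IsOpen {g : G | ρ g x = y} := by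
  rw [isOpen_iff_mem_nhds]
  intro g₀ hg₀
  have hopen : IsOpen ((fun g => g₀⁻¹ * g) ⁻¹' {g : G | ρ g x = x}) :=
    (hρ x).preimage (continuous_const_mul _)
  refine Filter.mem_of_superset (hopen.mem_nhds (by simp)) fun g hg => ?_
  simp only [Set.mem_preimage, Set.mem_ofPred_eq, map_mul, Module.End.mul_apply] at hg hg₀ ⊢
  rw [← hg₀]
  conv_rhs => rw [← hg]
  rw [← Module.End.mul_apply, ← map_mul]
  simp

/-- The finite intersection of the stabilizers of the support points is open and fixes the vector.
-/
theorem isDiscrete_perm {Ω : Type v} [MulAction G Ω]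
    (h : ∀ ω : Ω, IsOpen (MulAction.stabilizer G ω : Set G)) : IsDiscrete (perm G Ω) := by
  intro x
  have hU : IsOpen (⋂ ω ∈ x.coeff.support, (MulAction.stabilizer G ω : Set G)) :=
    isOpen_biInter_finset fun ω _ => h ω
  refine (vectorStabilizer (perm G Ω) x).isOpen_of_mem_nhds (g := 1)
    (Filter.mem_of_superset (hU.mem_nhds (by simp)) fun g hg => ?_)
  simp only [Set.mem_iInter, SetLike.mem_coe, MulAction.mem_stabilizer_iff] at hg
  change perm G Ω g x = x
  ext ω
  rw [coeff_ofMulAction]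
  by_cases hω : ω ∈ x.coeff.support
  · rw [inv_smul_eq_iff.2 (hg ω hω).symm]
  · by_cases hω' : g⁻¹ • ω ∈ x.coeff.support
    · have := hg _ hω'
      rw [smul_inv_smul] at this
      rw [← this]
    · rw [Finsupp.notMem_support_iff.1 hω, Finsupp.notMem_support_iff.1 hω']

/-- Averaging: a vector fixed by a compact subgroup lifts to a fixed vector. -/
theorem exists_fixed_lift {M : Type u} {N : Type v} [AddCommGroup M] [Module ℚ M]
    [AddCommGroup N] [Module ℚ N] {ρ : Representation ℚ G M} {σ : Representation ℚ G N}
    (hρ : IsDiscrete ρ) (p : IntertwiningMap ρ σ) (hp : Function.Surjective p)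
    (K : Subgroup G) (hK : IsCompact (K : Set G)) (y : N) (hy : ∀ k ∈ K, σ k y = y) :
    ∃ m : M, p m = y ∧ ∀ k ∈ K, ρ k m = m := by
  obtain ⟨m₀, hm₀⟩ := hp y
  -- The orbit of `m₀` is a continuous image of the compact `K` in a discrete space.
  have hfin : ((fun k => ρ k m₀) '' (K : Set G)).Finite := by
    let _ : TopologicalSpace M := ⊥
    have : DiscreteTopology M := ⟨rfl⟩
    refine (hK.image ?_).finite_of_discrete
    exact continuous_discrete_rng.2 fun b => hρ.isOpen_setOf_apply_eq m₀ b
  set F := hfin.toFinset with hF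
  have hmem : ∀ x, x ∈ F ↔ ∃ k ∈ K, ρ k m₀ = x := by intro x; simp [hF]
  have hcard : (F.card : ℚ) ≠ 0 := by
    have : m₀ ∈ F := (hmem _).2 ⟨1, K.one_mem, by simp⟩
    exact_mod_cast (Finset.card_pos.2 ⟨_, this⟩).ne'
  -- The average runs over the finite orbit `F`, which `K` permutes, so no Haar measure is needed.
  refine ⟨(F.card : ℚ)⁻¹ • ∑ x ∈ F, x, ?_, fun k hk => ?_⟩
  · have : ∀ x ∈ F, p x = y := by
      intro x hx
      obtain ⟨k, hk, rfl⟩ := (hmem x).1 hx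
      rw [p.isIntertwining, hm₀, hy k hk]
    rw [map_smul, map_sum, Finset.sum_congr rfl this, Finset.sum_const, ← Nat.cast_smul_eq_nsmul ℚ,
      smul_smul, inv_mul_cancel₀ hcard, one_smul]
  · rw [map_smul, map_sum]
    congr 1
    refine Finset.sum_nbij' (fun x => ρ k x) (fun x => ρ k⁻¹ x) ?_ ?_ ?_ ?_ ?_
    · intro x hx
      obtain ⟨l, hl, rfl⟩ := (hmem x).1 hx
      exact (hmem _).2 ⟨k * l, K.mul_mem hk hl, by simp⟩
    · intro x hx
      obtain ⟨l, hl, rfl⟩ := (hmem x).1 hx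
      exact (hmem _).2 ⟨k⁻¹ * l, K.mul_mem (K.inv_mem hk) hl, by simp⟩
    · intro x _; simp
    · intro x _; simp
    · intro x _; rfl

end Discrete

/-! ### Morphisms out of permutation modules. -/

section Lift

variable {G : Type u} [Group G]

/-- The linear map `ℚ[Ω] → V` with prescribed values on the basis. -/
noncomputable def basisLift {Ω V : Type*} [AddCommGroup V] [Module ℚ V] (v : Ω → V) :
    ℚ[Ω] →ₗ[ℚ] V :=
  Finsupp.linearCombination ℚ v ∘ₗ (MonoidAlgebra.coeffLinearEquiv ℚ).toLinearMap

theorem basisLift_apply {Ω V : Type*} [AddCommGroup V] [Module ℚ V] (v : Ω → V) (x : ℚ[Ω]) :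
    basisLift v x = x.coeff.sum fun ω a => a • v ω :=
  Finsupp.linearCombination_apply ℚ x.coeff

@[simp]
theorem basisLift_single {Ω V : Type*} [AddCommGroup V] [Module ℚ V] (v : Ω → V) (ω : Ω) (a : ℚ) :
    basisLift v (MonoidAlgebra.single ω a) = a • v ω :=
  Finsupp.linearCombination_single ℚ a ω

theorem linearMap_ext_single {Ω V : Type*} [AddCommGroup V] [Module ℚ V] {f g : ℚ[Ω] →ₗ[ℚ] V}
    (h : ∀ ω, f (MonoidAlgebra.single ω 1) = g (MonoidAlgebra.single ω 1)) : f = g := by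
  refine MonoidAlgebra.lhom_ext' fun ω => LinearMap.ext_ring ?_
  exact h ω

/-- A morphism out of a permutation module is given by values at orbit representatives fixed by
the stabilizers. -/
theorem exists_perm_lift {Ω : Type*} [MulAction G Ω] {V : Type*} [AddCommGroup V] [Module ℚ V]
    (ρ : Representation ℚ G V) (P : Ω → V → Prop)
    (hP : ∀ (g : G) (ω : Ω) (x : V), P ω x → P (g • ω) (ρ g x))
    (hex : ∀ ω, ∃ x, P ω x ∧ ∀ k ∈ MulAction.stabilizer G ω, ρ k x = x) :
    ∃ l : IntertwiningMap (Representation.ofMulAction ℚ G Ω) ρ,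
      ∀ ω, P ω (l (MonoidAlgebra.single ω 1)) := by
  choose m hm hfix using hex
  let r : Ω → Ω := fun ω => (Quotient.mk (MulAction.orbitRel G Ω) ω).out
  have hr : ∀ ω, ∃ g : G, g • r ω = ω := fun ω =>
    (MulAction.orbitRel G Ω).symm (Quotient.mk_out (s := MulAction.orbitRel G Ω) ω)
  have hrs : ∀ (g : G) ω, r (g • ω) = r ω := fun g ω => by
    have : (Quotient.mk (MulAction.orbitRel G Ω) (g • ω)) = Quotient.mk _ ω :=
      Quotient.sound ⟨g, rfl⟩
    simp only [r, this]
  choose t ht using hr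
  let v : Ω → V := fun ω => ρ (t ω) (m (r ω))
  have hv : ∀ (g : G) ω, v (g • ω) = ρ g (v ω) := by
    intro g ω
    -- The two transporters from `r ω` to `g • ω` differ by a stabilizer element, which fixes `m (r
    -- ω)`; hence the choice of `t` is harmless.
    have hk : (g * t ω)⁻¹ * t (g • ω) ∈ MulAction.stabilizer G (r ω) := by
      rw [MulAction.mem_stabilizer_iff, mul_smul, inv_smul_eq_iff, mul_smul, ht, ← hrs g ω, ht]
    have h1 := hfix _ _ hk
    simp only [v, hrs]
    rw [← Module.End.mul_apply, ← map_mul]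
    conv_rhs => rw [← h1]
    rw [← Module.End.mul_apply, ← map_mul, mul_inv_cancel_left]
  refine ⟨⟨basisLift v, fun g => linearMap_ext_single fun ω => ?_⟩, fun ω => ?_⟩
  · simp [hv]
  · change P ω (basisLift v _)
    have := hP (t ω) _ _ (hm (r ω))
    rw [ht] at this
    simpa using this

end Lift

/-! ### Projectivity and comparison of resolutions. -/

section Projective

variable {G : Type u} [Group G] [TopologicalSpace G]

/-- The image of a basis point is fixed by its compact stabilizer, so averaging gives a lift with
the same invariance. -/
theorem isProjectiveDiscrete_perm [IsTopologicalGroup G] {Ω : Type u} [MulAction G Ω] (hΩ : IsProperGSet G Ω) :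
    IsProjectiveDiscrete (perm G Ω) := by
  refine ⟨isDiscrete_perm hΩ.isOpen_stabilizer, ?_⟩
  intro M N _ _ _ _ ρ σ hρ _ p f hp
  obtain ⟨l, hl⟩ := exists_perm_lift ρ (fun ω x => p x = f (MonoidAlgebra.single ω 1))
    (fun g ω x hx => by
      rw [p.isIntertwining, hx, ← f.isIntertwining, ofMulAction_single])
    (fun ω => exists_fixed_lift hρ p hp _ (hΩ.isCompact_stabilizer ω) _ fun k hk => by
      rw [← f.isIntertwining, ofMulAction_single, MulAction.mem_stabilizer_iff.1 hk])
  exact ⟨l, IntertwiningMap.ext (linearMap_ext_single hl)⟩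

/-- Restriction of the codomain of a morphism to a submodule. -/
def codRestrict {G : Type*} [Group G] {V W : Type*} [AddCommGroup V] [Module ℚ V]
    [AddCommGroup W] [Module ℚ W] {ρ : Representation ℚ G V} {σ : Representation ℚ G W}
    (f : IntertwiningMap ρ σ) (N : Subrepresentation σ) (hf : ∀ x, f x ∈ N) :
    IntertwiningMap ρ N.toRepresentation :=
  ⟨f.toLinearMap.codRestrict N.toSubmodule hf, fun g => LinearMap.ext fun x =>
    Subtype.ext (f.isIntertwining _ _ g x)⟩

/-- Lifting along a map which need only cover the image. -/
theorem IsProjectiveDiscrete.exists_lift {P M N : Type u} [AddCommGroup P] [Module ℚ P]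
    [AddCommGroup M] [Module ℚ M] [AddCommGroup N] [Module ℚ N]
    {π : Representation ℚ G P} {ρ : Representation ℚ G M} {σ : Representation ℚ G N}
    (hπ : IsProjectiveDiscrete π) (hρ : IsDiscrete ρ) (hσ : IsDiscrete σ)
    (p : IntertwiningMap ρ σ) (f : IntertwiningMap π σ) (hf : ∀ x, ∃ y, p y = f x) :
    ∃ l : IntertwiningMap π ρ, ∀ x, p (l x) = f x := by
  let p' := codRestrict p p.range fun x => ⟨x, rfl⟩
  let f' := codRestrict f p.range hf
  obtain ⟨l, hl⟩ := hπ.2 _ _ _ _ hρ (isDiscrete_toRepresentation hσ _) p' f'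
    (LinearMap.surjective_rangeRestrict _)
  refine ⟨l, fun x => ?_⟩
  have := congrArg (fun φ => (φ x : N)) hl
  exact this

/-- Lifting along maps to the trivial module. -/
theorem IsProjectiveDiscrete.exists_lift_trivial {P M : Type u} [AddCommGroup P] [Module ℚ P]
    [AddCommGroup M] [Module ℚ M] {π : Representation ℚ G P} {ρ : Representation ℚ G M}
    (hπ : IsProjectiveDiscrete π) (hρ : IsDiscrete ρ)
    (p : IntertwiningMap ρ (Representation.trivial ℚ G ℚ))
    (f : IntertwiningMap π (Representation.trivial ℚ G ℚ)) (hp : Function.Surjective p) :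
    ∃ l : IntertwiningMap π ρ, ∀ x, p (l x) = f x := by
  -- Projectivity is tested on modules in universe `u`, so the target `ℚ` is lifted there.
  let τ : Representation ℚ G (ULift.{u} ℚ) := Representation.trivial ℚ G _
  let e : ℚ ≃ₗ[ℚ] ULift.{u} ℚ := ULift.moduleEquiv.symm
  let p' : IntertwiningMap ρ τ := ⟨e.toLinearMap ∘ₗ p.toLinearMap, fun g => LinearMap.ext fun x =>
    congrArg e (p.isIntertwining _ _ g x)⟩
  let f' : IntertwiningMap π τ := ⟨e.toLinearMap ∘ₗ f.toLinearMap, fun g => LinearMap.ext fun x =>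
    congrArg e (f.isIntertwining _ _ g x)⟩
  obtain ⟨l, hl⟩ := hπ.exists_lift hρ (isDiscrete_trivial _) p' f' fun x => by
    obtain ⟨y, hy⟩ := hp (f x)
    exact ⟨y, congrArg e hy⟩
  exact ⟨l, fun x => e.injective (hl x)⟩

/-- An augmented sequence of `ℚ[G]`-modules. -/
structure AugSeq (G : Type u) [Group G] where
  X : ℕ → Type u
  [addCommGroup : ∀ i, AddCommGroup (X i)]
  [module : ∀ i, Module ℚ (X i)]
  rep : ∀ i, Representation ℚ G (X i)
  aug : IntertwiningMap (rep 0) (Representation.trivial ℚ G ℚ)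
  d : ∀ i, IntertwiningMap (rep (i + 1)) (rep i)

attribute [instance] AugSeq.addCommGroup AugSeq.module

/-- The cycles in degree `i`. -/
noncomputable def AugSeq.ker {G : Type u} [Group G] (C : AugSeq G) :
    ∀ i, Subrepresentation (C.rep i)
  | 0 => C.aug.ker
  | i + 1 => (C.d i).ker

/-- Exactness below degree `n`, and projectivity in degrees up to `n`. -/
structure AugSeq.IsPartialProjective (C : AugSeq G) (n : ℕ) : Prop where
  projective : ∀ i ≤ n, IsProjectiveDiscrete (C.rep i)
  surjective_aug : Function.Surjective C.aug
  exact : ∀ i < n, (C.d i).range = C.ker i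

theorem AugSeq.IsPartialProjective.mono {C : AugSeq G} {m n : ℕ} (h : C.IsPartialProjective n)
    (hmn : m ≤ n) : C.IsPartialProjective m :=
  ⟨fun i hi => h.projective i (hi.trans hmn), h.surjective_aug,
    fun i hi => h.exact i (hi.trans_le hmn)⟩

/-- Comparison of two partial projective resolutions: in the top degree, the identity on cycles
factors as a sum of a map through the other resolution and a map extending to all chains. -/
theorem AugSeq.exists_comparison (C D : AugSeq G) (n : ℕ) (hC : C.IsPartialProjective n)
    (hD : D.IsPartialProjective n) :
    ∃ (f : IntertwiningMap (C.rep n) (D.rep n)) (g : IntertwiningMap (D.rep n) (C.rep n))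
      (h : IntertwiningMap (C.rep n) (C.rep n)),
      (∀ z ∈ C.ker n, f z ∈ D.ker n) ∧ (∀ z ∈ D.ker n, g z ∈ C.ker n) ∧
      (∀ c, h c ∈ C.ker n) ∧ ∀ z ∈ C.ker n, z = g (f z) + h z := by
  induction n with
  | zero =>
    have hCp := hC.projective 0 le_rfl
    have hDp := hD.projective 0 le_rfl
    obtain ⟨f, hf⟩ := hCp.exists_lift_trivial hDp.1 D.aug C.aug hD.surjective_aug
    obtain ⟨g, hg⟩ := hDp.exists_lift_trivial hCp.1 C.aug D.aug hC.surjective_aug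
    refine ⟨f, g, IntertwiningMap.id _ - g.comp f, ?_, ?_, ?_, ?_⟩
    · intro z hz
      exact (hf z).trans hz
    · intro z hz
      exact (hg z).trans hz
    · intro c
      change C.aug (c - g (f c)) = 0
      rw [map_sub, hg, hf, sub_self]
    · intro z _
      change z = g (f z) + (z - g (f z))
      abel
  | succ n ih =>
    obtain ⟨f, g, h, hf, hg, hh, hsum⟩ := ih (hC.mono n.le_succ) (hD.mono n.le_succ)
    have hCp := hC.projective (n + 1) le_rfl
    have hDp := hD.projective (n + 1) le_rfl
    have hCn := hC.projective n n.le_succ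
    have hDn := hD.projective n n.le_succ
    have hCe := hC.exact n n.lt_succ_self
    have hDe := hD.exact n n.lt_succ_self
    have hCm : ∀ c, C.d n c ∈ C.ker n := fun c => hCe ▸ ⟨c, rfl⟩
    have hDm : ∀ c, D.d n c ∈ D.ker n := fun c => hDe ▸ ⟨c, rfl⟩
    -- `h` takes values in cycles on all of `C.rep n`, so it lifts through `C.d n` to the homotopy
    -- `k` below; the correction `k ∘ d` vanishes on the new cycles.
    have hCl : ∀ z ∈ C.ker n, ∃ y, C.d n y = z := fun z hz => by
      rw [← hCe] at hz
      exact hz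
    have hDl : ∀ z ∈ D.ker n, ∃ y, D.d n y = z := fun z hz => by
      rw [← hDe] at hz
      exact hz
    obtain ⟨F, hF⟩ := hCp.exists_lift hDp.1 hDn.1 (D.d n) (f.comp (C.d n))
      fun x => hDl _ (hf _ (hCm x))
    obtain ⟨E, hE⟩ := hDp.exists_lift hCp.1 hCn.1 (C.d n) (g.comp (D.d n))
      fun x => hCl _ (hg _ (hDm x))
    obtain ⟨k, hk⟩ := hCn.exists_lift hCp.1 hCn.1 (C.d n) h fun x => hCl _ (hh x)
    simp only [IntertwiningMap.comp_apply] at hF hE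
    refine ⟨F, E, IntertwiningMap.id _ - E.comp F - k.comp (C.d n), ?_, ?_, ?_, ?_⟩
    · intro z hz
      change D.d n (F z) = 0
      rw [hF, show C.d n z = 0 from hz, map_zero]
    · intro z hz
      change C.d n (E z) = 0
      rw [hE, show D.d n z = 0 from hz, map_zero]
    · intro c
      change C.d n (c - E (F c) - k (C.d n c)) = 0
      rw [map_sub, map_sub, hE, hF, hk, sub_sub, sub_eq_zero]
      exact hsum _ (hCm c)
    · intro z hz
      change z = E (F z) + (z - E (F z) - k (C.d n z))
      rw [show C.d n z = 0 from hz, map_zero]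
      abel

end Projective

/-! ### The $\ell_1$-norm. -/

section L1Norm

variable {Ω Λ : Type*}

theorem l1Norm_eq_sum (x : ℚ[Ω]) {s : Finset Ω} (hs : x.coeff.support ⊆ s) :
    l1Norm x = ∑ ω ∈ s, |(x.coeff ω : ℝ)| :=
  Finsupp.sum_of_support_subset _ hs _ (by simp)

theorem l1Norm_nonneg (x : ℚ[Ω]) : 0 ≤ l1Norm x :=
  Finset.sum_nonneg fun _ _ => abs_nonneg _

@[simp]
theorem l1Norm_zero : l1Norm (0 : ℚ[Ω]) = 0 := by
  simp [l1Norm]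

theorem eq_zero_of_l1Norm_eq_zero {x : ℚ[Ω]} (h : l1Norm x = 0) : x = 0 := by
  rw [l1Norm_eq_sum x subset_rfl, Finset.sum_eq_zero_iff_of_nonneg fun _ _ => abs_nonneg _] at h
  ext ω
  by_contra hω
  have := h ω (Finsupp.mem_support_iff.2 hω)
  simp only [abs_eq_zero, Rat.cast_eq_zero] at this
  exact hω this

theorem l1Norm_add_le (x y : ℚ[Ω]) : l1Norm (x + y) ≤ l1Norm x + l1Norm y := by
  classical
  rw [l1Norm_eq_sum x Finset.subset_union_left, l1Norm_eq_sum y Finset.subset_union_right,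
    l1Norm_eq_sum (x + y) Finsupp.support_add, ← Finset.sum_add_distrib]
  refine Finset.sum_le_sum fun ω _ => ?_
  simp only [MonoidAlgebra.coeff_add, Finsupp.add_apply, Rat.cast_add]
  exact abs_add_le _ _

theorem l1Norm_smul (a : ℚ) (x : ℚ[Ω]) : l1Norm (a • x) = |(a : ℝ)| * l1Norm x := by
  rw [l1Norm_eq_sum (a • x) (s := x.coeff.support) (Finsupp.support_smul (g := x.coeff)),
    l1Norm_eq_sum x subset_rfl, Finset.mul_sum]
  simp [abs_mul]

theorem l1Norm_sum_le {ι : Type*} (s : Finset ι) (x : ι → ℚ[Ω]) :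
    l1Norm (∑ i ∈ s, x i) ≤ ∑ i ∈ s, l1Norm (x i) :=
  Finset.le_sum_of_subadditive _ l1Norm_zero.le l1Norm_add_le _ _

theorem l1Norm_ofMulAction {G : Type*} [Group G] [MulAction G Ω] (g : G) (x : ℚ[Ω]) :
    l1Norm (Representation.ofMulAction ℚ G Ω g x) = l1Norm x := by
  classical
  rw [l1Norm_eq_sum x subset_rfl,
    l1Norm_eq_sum _ (s := x.coeff.support.image (g • ·)) (fun ω hω => ?_),
    Finset.sum_image fun a _ b _ h => MulAction.injective g h]
  · simp
  · rw [Finsupp.mem_support_iff, coeff_ofMulAction] at hω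
    exact Finset.mem_image.2 ⟨g⁻¹ • ω, Finsupp.mem_support_iff.2 hω, smul_inv_smul g ω⟩

theorem l1Norm_basisLift_le (v : Ω → ℚ[Λ]) (K : ℝ) (y : ℚ[Ω])
    (hv : ∀ ω ∈ y.coeff.support, l1Norm (v ω) ≤ K) : l1Norm (basisLift v y) ≤ K * l1Norm y := by
  rw [basisLift_apply, l1Norm_eq_sum y subset_rfl, Finset.mul_sum]
  refine (l1Norm_sum_le _ _).trans (Finset.sum_le_sum fun ω hω => ?_)
  rw [l1Norm_smul, mul_comm]
  exact mul_le_mul_of_nonneg_right (hv ω hω) (abs_nonneg _)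

end L1Norm

/-! ### Linearly bounded lifts. -/

section Filling

variable {G : Type*} [Group G] {V : Type*} [AddCommGroup V] [Module ℚ V]
  {ρ : Representation ℚ G V}

/-- Linearly bounded lifting along a surjection, for elements supported in finitely many orbits. -/
theorem exists_bounded_lift {Λ Ω : Type*} [MulAction G Λ] [MulAction G Ω]
    (del : IntertwiningMap (Representation.ofMulAction ℚ G Λ) ρ) (hdel : Function.Surjective del)
    (φ : IntertwiningMap (Representation.ofMulAction ℚ G Ω) ρ) (T : Finset Ω) :
    ∃ K : ℝ, 0 < K ∧ ∀ y : ℚ[Ω], (∀ ω ∈ y.coeff.support, ∃ t ∈ T, ∃ g : G, g • t = ω) →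
      ∃ x, del x = φ y ∧ l1Norm x ≤ K * l1Norm y := by
  choose m hm using fun t => hdel (φ (MonoidAlgebra.single t 1))
  have hsum : 0 ≤ ∑ t ∈ T, l1Norm (m t) := Finset.sum_nonneg fun _ _ => l1Norm_nonneg _
  -- Translation preserves the norm, so lifts of the representatives in `T` bound all relevant
  -- lifts; the `+ 1` keeps the constant positive.
  refine ⟨∑ t ∈ T, l1Norm (m t) + 1, by linarith, fun y hy => ?_⟩
  have key : ∀ ω, ∃ x, del x = φ (MonoidAlgebra.single ω 1) ∧
      (ω ∈ y.coeff.support → l1Norm x ≤ ∑ t ∈ T, l1Norm (m t) + 1) := by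
    intro ω
    by_cases hω : ω ∈ y.coeff.support
    · obtain ⟨t, ht, g, rfl⟩ := hy ω hω
      refine ⟨Representation.ofMulAction ℚ G Λ g (m t), ?_, fun _ => ?_⟩
      · rw [del.isIntertwining, hm, ← φ.isIntertwining, ofMulAction_single]
      · rw [l1Norm_ofMulAction]
        have := Finset.single_le_sum (f := fun t => l1Norm (m t))
          (fun _ _ => l1Norm_nonneg _) ht
        exact this.trans (le_add_of_nonneg_right zero_le_one)
    · exact ⟨m ω, hm ω, fun h => absurd h hω⟩
  choose v hv hvK using key
  refine ⟨basisLift v y, ?_, l1Norm_basisLift_le v _ y hvK⟩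
  have : del.toLinearMap ∘ₗ basisLift v = φ.toLinearMap := linearMap_ext_single fun ω => by
    simp [hv]
  exact congrArg (fun f => f y) this

theorem exists_orbit_representatives {Ω : Type*} [MulAction G Ω]
    (h : Finite (MulAction.orbitRel.Quotient G Ω)) :
    ∃ T : Finset Ω, ∀ ω, ∃ t ∈ T, ∃ g : G, g • t = ω := by
  classical
  have := Fintype.ofFinite (MulAction.orbitRel.Quotient G Ω)
  refine ⟨Finset.univ.image fun q : MulAction.orbitRel.Quotient G Ω => q.out, fun ω =>
    ⟨_, Finset.mem_image_of_mem _ (Finset.mem_univ (Quotient.mk (MulAction.orbitRel G Ω) ω)), ?_⟩⟩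
  exact (MulAction.orbitRel G Ω).symm (Quotient.mk_out (s := MulAction.orbitRel G Ω) ω)

theorem exists_bounded_lift_of_finite {Λ Ω : Type*} [MulAction G Λ] [MulAction G Ω]
    (h : Finite (MulAction.orbitRel.Quotient G Ω))
    (del : IntertwiningMap (Representation.ofMulAction ℚ G Λ) ρ) (hdel : Function.Surjective del)
    (φ : IntertwiningMap (Representation.ofMulAction ℚ G Ω) ρ) :
    ∃ K : ℝ, 0 < K ∧ ∀ y : ℚ[Ω], ∃ x, del x = φ y ∧ l1Norm x ≤ K * l1Norm y := by
  obtain ⟨T, hT⟩ := exists_orbit_representatives h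
  obtain ⟨K, hK, hb⟩ := exists_bounded_lift del hdel φ T
  exact ⟨K, hK, fun y => hb y fun ω _ => hT ω⟩

/-- Morphisms of permutation modules out of a finitely generated one are bounded. -/
theorem exists_l1Norm_le {Λ Ω : Type*} [MulAction G Λ] [MulAction G Ω]
    (h : Finite (MulAction.orbitRel.Quotient G Ω))
    (φ : IntertwiningMap (Representation.ofMulAction ℚ G Ω) (Representation.ofMulAction ℚ G Λ)) :
    ∃ K : ℝ, 0 < K ∧ ∀ y, l1Norm (φ y) ≤ K * l1Norm y := by
  obtain ⟨K, hK, hb⟩ := exists_bounded_lift_of_finite h (IntertwiningMap.id _)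
    Function.surjective_id φ
  refine ⟨K, hK, fun y => ?_⟩
  obtain ⟨x, hx, hle⟩ := hb y
  rwa [← hx]

end Filling

/-! ### Filling norms and bounded sections. -/

section FillingNorm

variable {G : Type u} [Group G] {V : Type v} [AddCommGroup V] [Module ℚ V]
  {ρ : Representation ℚ G V} {Ω : Type u} [MulAction G Ω]

theorem fillingPseudoNorm_le (del : IntertwiningMap (perm G Ω) ρ) (x : ℚ[Ω]) :
    fillingPseudoNorm del (del x) ≤ l1Norm x :=
  csInf_le ⟨0, by rintro _ ⟨y, _, rfl⟩; exact l1Norm_nonneg y⟩ ⟨x, rfl, rfl⟩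

theorem le_fillingPseudoNorm {del : IntertwiningMap (perm G Ω) ρ} (hdel : Function.Surjective del)
    {m : V} {B : ℝ} (h : ∀ x, del x = m → B ≤ l1Norm x) : B ≤ fillingPseudoNorm del m := by
  obtain ⟨x, hx⟩ := hdel m
  refine le_csInf ⟨_, x, hx, rfl⟩ ?_
  rintro _ ⟨y, hy, rfl⟩
  exact h y hy

variable [TopologicalSpace G]

theorem isFillingNorm_l1Norm (hΩ : IsFiniteProperGSet G Ω) :
    IsFillingNorm (perm G Ω) (l1Norm : ℚ[Ω] → ℝ) := by
  refine ⟨⟨Ω, inferInstance, IntertwiningMap.id _, hΩ, Function.surjective_id, ?_⟩,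
    fun x => eq_zero_of_l1Norm_eq_zero⟩
  funext x
  refine le_antisymm (le_fillingPseudoNorm Function.surjective_id fun y hy => ?_)
    (fillingPseudoNorm_le (IntertwiningMap.id (perm G Ω)) x)
  rw [← show y = x from hy]

/-- A section of the surjection inducing the filling norm of an undistorted submodule of a
finitely generated permutation module is bounded for the `ℓ₁`-norms. -/
theorem exists_section_bound {N : Subrepresentation (perm G Ω)} (hΩ : IsFiniteProperGSet G Ω)
    (hN : IsUndistorted N) :
    ∃ (Λ : Type u) (_ : MulAction G Λ) (π : IntertwiningMap (perm G Λ) N.toRepresentation),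
      IsFiniteProperGSet G Λ ∧ Function.Surjective π ∧
      ∀ s : IntertwiningMap N.toRepresentation (perm G Λ), ∃ K : ℝ, 0 < K ∧
        ∀ z : N.toSubmodule, l1Norm (s z) ≤ K * l1Norm (z : ℚ[Ω]) := by
  obtain ⟨_, ⟨⟨Λ₀, _, del, _, hdel, rfl⟩, _⟩, _, ⟨⟨Λ, _, π, hΛ, hπ, rfl⟩, _⟩, _, C, hC, hle⟩ := hN
  refine ⟨Λ, inferInstance, π, hΛ, hπ, fun s => ?_⟩
  obtain ⟨K, hK, hKb⟩ := exists_l1Norm_le hΛ.finite_orbits (s.comp π)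
  obtain ⟨L, hL, hLb⟩ := exists_bounded_lift_of_finite hΩ.finite_orbits del hdel
    (IntertwiningMap.id _)
  refine ⟨K * (C * L), by positivity, fun z => ?_⟩
  -- Every `π`-preimage `x` of `z` satisfies $\|s(z)\|_1=\|s\pi(x)\|_1\le K\|x\|_1$; pass to the
  -- infimum.
  have h1 : l1Norm (s z) / K ≤ fillingPseudoNorm π z :=
    le_fillingPseudoNorm hπ fun x hx => by
      rw [div_le_iff₀' hK, ← hx]
      exact hKb x
  have h2 : fillingPseudoNorm del (z : ℚ[Ω]) ≤ L * l1Norm (z : ℚ[Ω]) := by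
    obtain ⟨x, hx, hxl⟩ := hLb z
    rw [IntertwiningMap.id_apply] at hx
    exact (hx ▸ fillingPseudoNorm_le del x).trans hxl
  rw [div_le_iff₀' hK] at h1
  calc l1Norm (s z) ≤ K * fillingPseudoNorm π z := h1
    _ ≤ K * (C * fillingPseudoNorm del (z : ℚ[Ω])) := by gcongr; exact hle z
    _ ≤ K * (C * (L * l1Norm (z : ℚ[Ω]))) := by gcongr
    _ = _ := by ring

end FillingNorm

/-! ### Splitting over the cycles, and restriction to closed subgroups. -/

section Sequences

variable {G : Type u} [Group G] [TopologicalSpace G]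

/-- The sequence of permutation modules as a sequence of modules. -/
noncomputable def PermSeq.toAugSeq {G : Type u} [Group G] (R : PermSeq G) : AugSeq G where
  X i := ℚ[R.Ω i]
  rep i := Representation.ofMulAction ℚ G (R.Ω i)
  aug := R.aug
  d := R.d

theorem PermSeq.ker_toAugSeq {G : Type u} [Group G] (R : PermSeq G) (i : ℕ) :
    R.toAugSeq.ker i = R.ker i := by
  cases i <;> rfl

theorem PermSeq.IsPartialResolution.isPartialProjective [IsTopologicalGroup G] {R : PermSeq G}
    {n : ℕ} (h : R.IsPartialResolution G n) : R.toAugSeq.IsPartialProjective n where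
  projective i hi := isProjectiveDiscrete_perm (h.finiteProper i hi).toIsProperGSet
  surjective_aug := h.surjective_aug
  exact i hi := (h.exact i hi).trans (R.ker_toAugSeq i).symm

/-- A projective resolution as a sequence of modules. -/
noncomputable def ProjResolution.toAugSeq {m : ℕ} (E : ProjResolution G m) : AugSeq G where
  X := E.P
  addCommGroup := E.addCommGroup
  module := E.module
  rep := E.rep
  aug := E.aug
  d := E.d

theorem ProjResolution.exact {m : ℕ} (E : ProjResolution G m) :
    ∀ i, (E.toAugSeq.d i).range = E.toAugSeq.ker i
  | 0 => E.exact_zero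
  | i + 1 => E.exact_succ i

theorem ProjResolution.isPartialProjective {m : ℕ} (E : ProjResolution G m) (n : ℕ) :
    E.toAugSeq.IsPartialProjective n where
  projective i _ := E.projective i
  surjective_aug := E.surjective_aug
  exact i _ := E.exact i

theorem ProjResolution.injective_d {n : ℕ} (E : ProjResolution G (n + 1)) :
    Function.Injective (E.toAugSeq.d n) := by
  rw [injective_iff_map_eq_zero]
  intro x hx
  have hx' : x ∈ (E.toAugSeq.d (n + 1)).range := by
    rw [E.exact]
    exact hx
  obtain ⟨y, rfl⟩ := hx'
  have := E.eq_zero (n + 2) (by omega)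
  rw [show y = 0 from Subsingleton.elim (α := E.P (n + 2)) _ _]
  exact map_zero (E.toAugSeq.d (n + 1))

/-- Lifting along an injective map. -/
theorem exists_lift_of_injective {G : Type*} [Group G] {Z A B : Type*} [AddCommGroup Z]
    [Module ℚ Z] [AddCommGroup A] [Module ℚ A] [AddCommGroup B] [Module ℚ B]
    {ρ : Representation ℚ G Z} {σ : Representation ℚ G A} {τ : Representation ℚ G B}
    (j : IntertwiningMap σ τ) (hj : Function.Injective j) (f : IntertwiningMap ρ τ)
    (hf : ∀ z, ∃ a, j a = f z) : ∃ l : IntertwiningMap ρ σ, ∀ z, j (l z) = f z := by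
  choose l hl using hf
  refine ⟨⟨⟨⟨l, fun x y => hj ?_⟩, fun c x => hj ?_⟩, fun g => LinearMap.ext fun x => hj ?_⟩, hl⟩
  · rw [map_add, hl, hl, hl, map_add]
  · rw [RingHom.id_apply, map_smul, hl, hl, map_smul]
  · change j (l (ρ g x)) = j (σ g (l x))
    rw [hl, f.isIntertwining, j.isIntertwining, hl]

/-- If the cohomological dimension is at most `n + 1`, surjections onto the `n`-cycles split. -/
theorem exists_section_of_projResolution {C : AugSeq G} {n : ℕ} (hC : C.IsPartialProjective n)
    (E : ProjResolution G (n + 1)) {M : Type u} [AddCommGroup M] [Module ℚ M]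
    {ρ : Representation ℚ G M} (hρ : IsDiscrete ρ)
    {N : Subrepresentation (C.rep n)} (hN : C.ker n = N)
    (π : IntertwiningMap ρ N.toRepresentation) (hπ : Function.Surjective π) :
    ∃ s : IntertwiningMap N.toRepresentation ρ, ∀ z, π (s z) = z := by
  subst hN
  obtain ⟨f, g, h, hf, hg, hh, hsum⟩ :=
    C.exists_comparison E.toAugSeq n hC (E.isPartialProjective n)
  have hCn := hC.projective n le_rfl
  let ι : IntertwiningMap (C.ker n).toRepresentation (C.rep n) :=
    ⟨(C.ker n).toSubmodule.subtype, fun _ => rfl⟩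
  have hE : ∀ x, E.toAugSeq.d n x ∈ E.toAugSeq.ker n := fun x => E.exact n ▸ ⟨x, rfl⟩
  -- Injectivity of the last differential identifies the `n`-cycles of `E` with its projective top
  -- term, through which `f` factors.
  obtain ⟨l, hl⟩ := exists_lift_of_injective (E.toAugSeq.d n) E.injective_d (f.comp ι) fun z => by
    have := hf z z.2
    rw [← E.exact] at this
    exact this
  have hker := isDiscrete_toRepresentation hCn.1 (C.ker n)
  obtain ⟨a, ha⟩ := ((E.isPartialProjective (n + 1)).projective (n + 1) le_rfl).exists_lift hρ hker π
    (codRestrict (g.comp (E.toAugSeq.d n)) (C.ker n) fun x => hg _ (hE x)) fun x => hπ _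
  -- `h` starts from the projective module of all chains, so it lifts along `π` as well; the section
  -- is the sum of the two lifts.
  obtain ⟨b, hb⟩ := hCn.exists_lift hρ hker π (codRestrict h (C.ker n) hh) fun x => hπ _
  refine ⟨a.comp l + b.comp ι, fun z => Subtype.ext ?_⟩
  change ((π (a (l z) + b z) : (C.ker n).toSubmodule) : C.X n) = z
  rw [map_add, ha, hb]
  change g (E.toAugSeq.d n (l z)) + h z = z
  rw [hl]
  exact (hsum z z.2).symm

/-- The infimum defining `cdQ` is attained. -/
theorem nonempty_projResolution_of_cdQ {m : ℕ} (h : cdQ G = m) :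
    Nonempty (ProjResolution G m) := by
  have hne : {m : ℕ∞ | ∃ n : ℕ, Nonempty (ProjResolution G n) ∧ m = n}.Nonempty := by
    by_contra hempty
    rw [Set.not_nonempty_iff_eq_empty] at hempty
    rw [cdQ, hempty, sInf_empty] at h
    exact ENat.top_ne_natCast m h
  obtain ⟨n, hn, hnm⟩ := csInf_mem hne
  rw [← cdQ, h, Nat.cast_inj] at hnm
  exact hnm ▸ hn

/-- Restriction of a sequence of permutation modules to a subgroup. -/
noncomputable def PermSeq.restrict {G : Type u} [Group G] (R : PermSeq G) (H : Subgroup G) :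
    PermSeq H where
  Ω := R.Ω
  aug := ⟨R.aug.toLinearMap, fun g => R.aug.isIntertwining' g⟩
  d i := ⟨(R.d i).toLinearMap, fun g => (R.d i).isIntertwining' g⟩

/-- The new stabilizers are intersections with `H`; closedness of `H` keeps them compact. Finiteness
of the orbit set may be lost. -/
theorem IsProperGSet.restrict {Ω : Type v} [MulAction G Ω] (hΩ : IsProperGSet G Ω)
    {H : Subgroup G} (hH : IsClosed (H : Set G)) : IsProperGSet H Ω where
  nonempty := hΩ.nonempty
  isOpen_stabilizer ω := (hΩ.isOpen_stabilizer ω).preimage continuous_subtype_val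
  isCompact_stabilizer ω :=
    hH.isClosedEmbedding_subtypeVal.isCompact_preimage (hΩ.isCompact_stabilizer ω)

theorem PermSeq.mem_ker_restrict {G : Type u} [Group G] (R : PermSeq G) (H : Subgroup G) (n : ℕ)
    (z : ℚ[R.Ω n]) : z ∈ (R.restrict H).toAugSeq.ker n ↔ z ∈ R.ker n := by
  cases n <;> rfl

theorem PermSeq.IsPartialResolution.isPartialProjective_restrict [IsTopologicalGroup G]
    {R : PermSeq G} {n : ℕ} (h : R.IsPartialResolution G n) {H : Subgroup G}
    (hH : IsClosed (H : Set G)) : (R.restrict H).toAugSeq.IsPartialProjective n where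
  projective i hi :=
    isProjectiveDiscrete_perm ((h.finiteProper i hi).toIsProperGSet.restrict hH)
  surjective_aug := h.surjective_aug
  exact i hi := by
    ext z
    rw [← SetLike.mem_coe]
    refine Iff.trans ?_ (R.mem_ker_restrict H i z).symm
    rw [← h.exact i hi]
    rfl

theorem PermSeq.IsPartialResolution.mono {R : PermSeq G} {m n : ℕ}
    (h : R.IsPartialResolution G n) (hmn : m ≤ n) : R.IsPartialResolution G m :=
  ⟨fun i hi => h.finiteProper i (hi.trans hmn), h.surjective_aug,
    fun i hi => h.exact i (hi.trans_le hmn)⟩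

end Sequences

/-- The image of a finitely generated permutation module in another permutation module is
supported in finitely many orbits. -/
theorem exists_orbits_support {G : Type*} [Group G] {Λ Ω : Type*} [MulAction G Λ] [MulAction G Ω]
    (h : Finite (MulAction.orbitRel.Quotient G Ω))
    (φ : IntertwiningMap (Representation.ofMulAction ℚ G Ω) (Representation.ofMulAction ℚ G Λ)) :
    ∃ T : Finset Λ, ∀ y, ∀ l ∈ (φ y).coeff.support, ∃ t ∈ T, ∃ g : G, g • t = l := by
  classical
  obtain ⟨S, hS⟩ := exists_orbit_representatives h
  refine ⟨S.biUnion fun s => (φ (MonoidAlgebra.single s 1)).coeff.support, fun y l hl => ?_⟩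
  by_contra hT
  -- If `l` lies outside the orbits of `T`, its coordinate functional kills the image of every basis
  -- vector, hence all of the image.
  let ev : ℚ[Λ] →ₗ[ℚ] ℚ := Finsupp.lapply l ∘ₗ (MonoidAlgebra.coeffLinearEquiv ℚ).toLinearMap
  have h0 : ev ∘ₗ φ.toLinearMap = 0 := linearMap_ext_single fun ω => by
    by_contra hne
    obtain ⟨s, hs, g, rfl⟩ := hS ω
    refine hT ⟨g⁻¹ • l, Finset.mem_biUnion.2 ⟨s, hs, Finsupp.mem_support_iff.2 fun h0 => hne ?_⟩,
      g, smul_inv_smul g l⟩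
    change (φ (MonoidAlgebra.single (g • s) 1)).coeff l = 0
    rw [← ofMulAction_single, φ.isIntertwining, coeff_ofMulAction, h0]
  exact Finsupp.mem_support_iff.1 hl (congrArg (fun f => f y) h0)

/-! ### A criterion for undistortedness. -/

section Undistorted

variable {G : Type u} [Group G] [TopologicalSpace G] {Ω Λ : Type u} [MulAction G Ω]
  [MulAction G Λ]

/-- A submodule of a permutation module is undistorted if the surjection `δ` onto it admits
linearly bounded lifts. -/
theorem isUndistorted_of_bounded_lift (h₀ : IsFiniteProperGSet G Ω)
    (h₁ : IsFiniteProperGSet G Λ) {N : Subrepresentation (perm G Ω)}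
    (δ : IntertwiningMap (perm G Λ) N.toRepresentation) (hδ : Function.Surjective δ)
    (hb : ∃ K : ℝ, 0 < K ∧ ∀ z : N.toSubmodule, ∃ x, δ x = z ∧ l1Norm x ≤ K * l1Norm (z : ℚ[Ω])) :
    IsUndistorted N := by
  let δ' : IntertwiningMap (perm G Λ) (perm G Ω) :=
    ⟨N.toSubmodule.subtype ∘ₗ δ.toLinearMap, fun g => LinearMap.ext fun x =>
      congrArg Subtype.val (δ.isIntertwining _ _ g x)⟩
  obtain ⟨C, hC, hCb⟩ := exists_l1Norm_le h₁.finite_orbits δ'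
  -- Boundedness of `δ'` gives one half of the equivalence and also shows that the filling
  -- pseudo-norm separates points.
  have hle : ∀ z : N.toSubmodule, l1Norm (z : ℚ[Ω]) ≤ C * fillingPseudoNorm δ z := fun z => by
    rw [← div_le_iff₀' hC]
    refine le_fillingPseudoNorm hδ fun x hx => ?_
    rw [div_le_iff₀' hC, ← hx]
    exact hCb x
  refine ⟨l1Norm, isFillingNorm_l1Norm h₀, fillingPseudoNorm δ,
    ⟨⟨Λ, inferInstance, δ, h₁, hδ, rfl⟩, fun z hz => ?_⟩, ⟨C, hC, hle⟩, ?_⟩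
  · have := hle z
    rw [hz, mul_zero] at this
    exact Subtype.ext (eq_zero_of_l1Norm_eq_zero (le_antisymm this (l1Norm_nonneg _)))
  · obtain ⟨K, hK, hKb⟩ := hb
    refine ⟨K, hK, fun z => ?_⟩
    obtain ⟨x, rfl, hx⟩ := hKb z
    exact (fillingPseudoNorm_le δ x).trans hx

end Undistorted

end TDLC

/-! ### The theorem for closed subgroups. -/

open TDLC in
theorem mainTheorem2 {G : Type*} [Group G] [TopologicalSpace G] [IsTopologicalGroup G]
    [LocallyCompactSpace G] [TotallyDisconnectedSpace G] (n : ℕ)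
    (hFP : TDLC.IsTypeFPInfty G) (hcd : TDLC.cdQ G = ((n + 1 : ℕ) : ℕ∞))
    (hiso : TDLC.WeakLinearIsoperimetric G n)
    (H : Subgroup G) (hH : IsClosed (H : Set G)) (hHFP : TDLC.IsTypeFP H (n + 1)) :
    TDLC.WeakLinearIsoperimetric H n := by
  obtain ⟨R, hR, hund⟩ := hiso
  obtain ⟨S, hS⟩ := hHFP
  obtain ⟨E⟩ := nonempty_projResolution_of_cdQ hcd
  have hRn := hR.mono n.le_succ
  have hSn := hS.mono n.le_succ
  obtain ⟨Λ, _, π, hΛ, hπ, hbound⟩ := exists_section_bound (hR.finiteProper n n.le_succ) hund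
  obtain ⟨s, hs⟩ := exists_section_of_projResolution hRn.isPartialProjective E
    (isDiscrete_perm hΛ.isOpen_stabilizer) (R.ker_toAugSeq n) π hπ
  obtain ⟨K₃, hK₃, hsb⟩ := hbound s
  obtain ⟨f, g, h, hf, hg, hh, hsum⟩ := S.toAugSeq.exists_comparison (R.restrict H).toAugSeq n
    hSn.isPartialProjective (hRn.isPartialProjective_restrict hH)
  simp only [S.ker_toAugSeq] at hf hg hh hsum
  replace hf : ∀ z ∈ S.ker n, f z ∈ R.ker n := fun z hz => (R.mem_ker_restrict H n _).1 (hf z hz)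
  replace hg : ∀ z ∈ R.ker n, g z ∈ S.ker n := fun z hz => hg z ((R.mem_ker_restrict H n _).2 hz)
  have hexact := hS.exact n n.lt_succ_self
  have hdm : ∀ y, S.d n y ∈ S.ker n := fun y => hexact ▸ ⟨y, rfl⟩
  let δ := codRestrict (S.d n) (S.ker n) hdm
  have hδ : Function.Surjective δ := fun z => by
    have hz : (z : ℚ[S.Ω n]) ∈ (S.d n).range := by
      rw [hexact]
      exact z.2
    obtain ⟨y, hy⟩ := hz
    exact ⟨y, Subtype.ext hy⟩
  -- Precomposing $sf$ with the boundary map gives a finitely generated permutation module as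
  -- source, which confines its image to the orbits of `T`.
  let φ : IntertwiningMap (perm H (S.Ω (n + 1))) (perm H Λ) :=
    ⟨s.toLinearMap ∘ₗ (f.toLinearMap ∘ₗ (S.d n).toLinearMap).codRestrict (R.ker n).toSubmodule
        (fun y => hf _ (hdm y)), fun a => LinearMap.ext fun y => by
      refine Eq.trans (congrArg s (Subtype.ext ?_)) (s.isIntertwining _ _ (a : G) _)
      exact (f.comp (S.d n)).isIntertwining _ _ a y⟩
  obtain ⟨T, hT⟩ := exists_orbits_support (hS.finiteProper (n + 1) le_rfl).finite_orbits φ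
  let ψ : IntertwiningMap (perm H Λ) (perm H (S.Ω n)) :=
    ⟨g.toLinearMap ∘ₗ (R.ker n).toSubmodule.subtype ∘ₗ π.toLinearMap, fun a =>
      LinearMap.ext fun y => by
        refine Eq.trans (congrArg g ?_) (g.isIntertwining _ _ a _)
        exact congrArg Subtype.val (π.isIntertwining _ _ (a : G) y)⟩
  obtain ⟨K₁, hK₁, hb₁⟩ := exists_bounded_lift δ hδ
    (codRestrict ψ (S.ker n) fun w => hg _ (π w).2) T
  obtain ⟨K₂, hK₂, hb₂⟩ := exists_bounded_lift_of_finite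
    (hS.finiteProper n n.le_succ).finite_orbits δ hδ (codRestrict h (S.ker n) hh)
  obtain ⟨K₄, hK₄, hfb⟩ := exists_l1Norm_le (hS.finiteProper n n.le_succ).finite_orbits
    (Λ := R.Ω n) f
  -- The constant adds the cost of filling $g\pi s f(z)$, namely `K₁` after the bounds `K₃` for `s`
  -- and `K₄` for `f`, to the cost `K₂` of filling `h z`.
  refine ⟨S, hS, isUndistorted_of_bounded_lift (hS.finiteProper n n.le_succ)
    (hS.finiteProper (n + 1) le_rfl) δ hδ ⟨K₁ * (K₃ * K₄) + K₂, by positivity, fun z => ?_⟩⟩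
  obtain ⟨y, hy⟩ := hδ z
  have hy' : S.d n y = z := congrArg Subtype.val hy
  have hφ : φ y = s ⟨f z.1, hf z.1 z.2⟩ :=
    congrArg s (Subtype.ext (congrArg f hy'))
  obtain ⟨x₁, hx₁, hx₁b⟩ := hb₁ (φ y) (hT y)
  obtain ⟨x₂, hx₂, hx₂b⟩ := hb₂ z
  refine ⟨x₁ + x₂, Subtype.ext ?_, ?_⟩
  · rw [map_add, hx₁, hx₂, hφ]
    refine Eq.trans ?_ (hsum z.1 z.2).symm
    exact congrArg (fun w : (R.ker n).toSubmodule => g w.1 + h z.1) (hs ⟨f z.1, hf z.1 z.2⟩)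
  · rw [hφ] at hx₁b
    calc l1Norm (x₁ + x₂) ≤ l1Norm x₁ + l1Norm x₂ := l1Norm_add_le _ _
      _ ≤ K₁ * (K₃ * (K₄ * l1Norm (z : ℚ[S.Ω n]))) + K₂ * l1Norm (z : ℚ[S.Ω n]) := by
        refine add_le_add (hx₁b.trans ?_) hx₂b
        gcongr
        refine (hsb _).trans ?_
        gcongr
        exact hfb z
      _ = _ := by ring
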